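/- **Conventions.** A locale $X$ is given by its frame $\mathcal O(X)$ of opens; a continuous map $f\colon X\to Y$ is a frame homomorphism $f^*\colon\mathcal O(Y)\to\mathcal O(X)$. An open $U$ is *compact* if, for every (inhabited) directed family $(V_i)$ with $U\le\bigvee_i V_i$, there is $i$ with $U\le V_i$; it is *clopen* if it is complemented in $\mathcal O(X)$. A continuous map $f$ is *spectral* if $f^*$ sends compact opens to compact opens. A *base* of $X$ is a family of opens such that every open is the join of a directed subfamily. $X$ is *spectral* if it has a base of compact opens that contains the top open and is closed under binary meets, and *Stone* if it has a base of compact clopens that contains the top open. $\mathrm{Pt}(X)$ is the set of points of $X$, i.e. of continuous maps $\mathbf 1\to X$ from the terminal locale (frame homomorphisms from $\mathcal O(X)$ to the frame $\Omega$ of propositions), and $\mathrm{SpecPt}(X)$ is the set of those points that are spectral maps. $\mathrm{Patch}(X)$ is the locale whose frame consists of the Scott continuous nuclei on $\mathcal O(X)$, ordered pointwise, and $\varepsilon\colon\mathrm{Patch}(X)\to X$ is the continuous map with $\varepsilon^*(U)=(V\mapsto U\vee V)$. A *Scott domain* is a pointed dcpo $D$ such that, for every $x\in D$, the finite (i.e.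 compact) elements below $x$ form a directed set with least upper bound $x$; every subset with an upper bound has a least upper bound; and it is decidable whether two finite elements have a common upper bound. $\Sigma D$ is the locale whose frame consists of the Scott open subsets of $D$. An element $x\in D$ is *sharp* if the proposition $c\sqsubseteq x$ is decidable for every finite $c\in D$; $\mathrm{Sharp}(D)$ is the set of sharp elements. (Here "$P$ is decidable" means $P\vee\neg P$; classically this holds automatically.) **Theorem.** 1. For every Scott domain $D$, the locale $\Sigma D$ is spectral, and there are bijections $$\mathrm{Sharp}(D)\;\simeq\;\mathrm{SpecPt}(\Sigma D)\;\simeq\;\mathrm{SpecPt}(\mathrm{Patch}(\Sigma D))\;\simeq\;\mathrm{Pt}(\mathrm{Patch}(\Sigma D)),$$ where the first sends $x$ to the point $U\mapsto (x\in U)$, the second sends $p$ to a point $\bar p$ with $\varepsilon\circ\bar p=p$, and the third is the inclusion. 2. For every spectral locale $X$, the locale $\mathrm{Patch}(X)$ with $\varepsilon$ has the universal property of the patch locale: $\mathrm{Patch}(X)$ is Stone, $\varepsilon$ is spectral, and for every Stone locale $A$ and every spectral map $f\colon A\to X$ there is a unique continuous map $\bar f\colon A\to\mathrm{Patch}(X)$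 with $\varepsilon\circ\bar f=f$. Moreover there are bijections $$\mathrm{SpecPt}(X)\;\simeq\;\mathrm{SpecPt}(\mathrm{Patch}(X))\;\simeq\;\mathrm{Pt}(\mathrm{Patch}(X)),$$ where the first sends $p$ to a point $\bar p$ with $\varepsilon\circ\bar p=p$, and the second is the inclusion. -/

import Mathlib

universe u

namespace PointFree

/-! ## Scott domains and sharp elements -/

section Domains

variable (D : Type u) [PartialOrder D]

/-- A dcpo: every directed (in particular inhabited) subset has a least upper bound. -/
structure IsDcpo : Prop where
  exists_isLUB : ∀ s : Set D, s.Nonempty → DirectedOn (· ≤ ·) s → ∃ x, IsLUB s x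

/-- An algebraic dcpo: the finite (that is, compact) elements below any `x` form a directed set
whose least upper bound is `x`. -/
structure IsAlgebraicDcpo : Prop extends IsDcpo D where
  nonempty_below : ∀ x : D, {c : D | IsCompactElement c ∧ c ≤ x}.Nonempty
  directedOn_below : ∀ x : D, DirectedOn (· ≤ ·) {c : D | IsCompactElement c ∧ c ≤ x}
  isLUB_below : ∀ x : D, IsLUB {c : D | IsCompactElement c ∧ c ≤ x} x

/-- A Scott domain: a pointed algebraic dcpo that is bounded complete and in which boundedness of
pairs of finite elements is decidable. -/
structure IsScottDomain : Prop extends IsAlgebraicDcpo D where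
  pointed : ∃ b : D, IsBot b
  bounded_complete : ∀ s : Set D, BddAbove s → ∃ x, IsLUB s x
  decidable_bounded : ∀ c d : D, IsCompactElement c → IsCompactElement d →
    (∃ v, c ≤ v ∧ d ≤ v) ∨ ¬ ∃ v, c ≤ v ∧ d ≤ v

variable {D} in
/-- An element `x` is sharp if `c ≤ x` is decidable for every finite element `c`. -/
def IsSharp (x : D) : Prop :=
  ∀ c : D, IsCompactElement c → c ≤ x ∨ ¬ c ≤ x

/-- The type of sharp elements. -/
def Sharp : Type u := {x : D // IsSharp x}

/-- The Scott locale of `D`, given by its frame of Scott open subsets (upward closed subsets that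
are inaccessible by directed joins). -/
abbrev ScottLocale : Type u := TopologicalSpace.Opens (Topology.WithScott D)

end Domains

/-! ## Locales

A locale `X` is represented by its frame of opens, and a continuous map `X → Y` by the frame
homomorphism `FrameHom Y X` in the opposite direction. The terminal locale is given by the
frame `Prop`. The compact opens are the compact elements of the frame. -/

section Locales

/-- `B` is a base: every open is the join of a directed subfamily of `B`. -/
def IsBase {X : Type u} [Order.Frame X] {ι : Type u} (B : ι → X) : Prop :=
  ∀ U : X, ∃ s : Set ι, s.Nonempty ∧ DirectedOn (fun i j => B i ≤ B j) s ∧ U = ⨆ i ∈ s, B i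

/-- A spectral locale: there is a base of compact opens that contains the top open and is closed
under binary meets. -/
def IsSpectralLocale (X : Type u) [Order.Frame X] : Prop :=
  ∃ (ι : Type u) (B : ι → X), IsBase B ∧ (∀ i, IsCompactElement (B i)) ∧
    (∃ i, B i = ⊤) ∧ (∀ i j, ∃ k, B k = B i ⊓ B j)

/-- A Stone locale: there is a base of compact clopens that contains the top open. -/
def IsStoneLocale (X : Type u) [Order.Frame X] : Prop :=
  ∃ (ι : Type u) (B : ι → X), IsBase B ∧ (∀ i, IsCompactElement (B i)) ∧
    (∃ i, B i = ⊤) ∧ (∀ i, IsComplemented (B i))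

/-- A continuous map `X → Y` is spectral if inverse images of compact opens are compact. -/
def IsSpectralHom {X Y : Type*} [Order.Frame X] [Order.Frame Y] (f : FrameHom Y X) : Prop :=
  ∀ K : Y, IsCompactElement K → IsCompactElement (f K)

/-- The points of a locale: continuous maps from the terminal locale. -/
abbrev Pt (X : Type u) [Order.Frame X] : Type u := FrameHom X Prop

/-- The spectral points of a locale. -/
def SpecPt (X : Type u) [Order.Frame X] : Type u := {p : Pt X // IsSpectralHom p}

end Locales

/-! ## The patch locale -/

section Patch

/-- The patch locale of `X`, given by the frame of Scott continuous nuclei on the frame of `X`,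
ordered pointwise. -/
def Patch (X : Type u) [Order.Frame X] : Type u := {j : Nucleus X // ScottContinuous j}

namespace Patch

variable {X : Type u} [Order.Frame X]

instance : PartialOrder (Patch X) :=
  inferInstanceAs (PartialOrder {j : Nucleus X // ScottContinuous j})

theorem le_def {j k : Patch X} : j ≤ k ↔ ∀ U : X, j.1 U ≤ k.1 U := Iff.rfl

/-- The composite of a list of nuclei. -/
def comps (l : List (Nucleus X)) (U : X) : X := l.foldr (fun k V => k V) U

theorem comps_append (l m : List (Nucleus X)) (U : X) :
    comps (l ++ m) U = comps l (comps m U) := by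
  simp [comps]

theorem comps_inf (l : List (Nucleus X)) (U V : X) :
    comps l (U ⊓ V) = comps l U ⊓ comps l V := by
  induction l with
  | nil => rfl
  | cons k l ih =>
    change k (comps l (U ⊓ V)) = k (comps l U) ⊓ k (comps l V)
    rw [ih, Nucleus.map_inf]

theorem comps_mono (l : List (Nucleus X)) : Monotone (comps l) := by
  intro U V h
  have := comps_inf l U V
  rw [inf_eq_left.2 h] at this
  exact inf_eq_left.1 this.symm

theorem le_comps (l : List (Nucleus X)) (U : X) : U ≤ comps l U := by
  induction l with
  | nil => exact le_rfl
  | cons k l ih => exact ih.trans k.le_apply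

theorem comps_scott (l : List (Nucleus X)) (hl : ∀ k ∈ l, ScottContinuous k) :
    ScottContinuous (comps l) := by
  induction l with
  | nil =>
    intro d _ _ a ha
    change IsLUB ((fun U => U) '' d) a
    simpa using ha
  | cons k l ih =>
    intro d hd hdir a ha
    have h1 := ih (fun k hk => hl k (List.mem_cons_of_mem _ hk)) hd hdir ha
    have h2 := hl k List.mem_cons_self (hd.image _) (hdir.mono_comp (comps_mono l)) h1
    rw [Set.image_image] at h2
    exact h2

theorem comps_le {l : List (Nucleus X)} {n : Nucleus X} (h : ∀ k ∈ l, k ≤ n) (U : X) :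
    comps l U ≤ n U := by
  induction l with
  | nil => exact n.le_apply
  | cons k l ih =>
    calc k (comps l U) ≤ k (n U) := k.monotone (ih fun k hk => h k (List.mem_cons_of_mem _ hk))
      _ ≤ n (n U) := h k List.mem_cons_self _
      _ = n U := n.idempotent U

/-- The lists of members of a set of Scott continuous nuclei. -/
def Lists (S : Set (Patch X)) : Set (List (Nucleus X)) :=
  {l | ∀ k ∈ l, ∃ j ∈ S, j.1 = k}

theorem append_mem {S : Set (Patch X)} {l m : List (Nucleus X)} (hl : l ∈ Lists S)
    (hm : m ∈ Lists S) : l ++ m ∈ Lists S := by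
  intro k hk
  rcases List.mem_append.1 hk with h | h
  · exact hl k h
  · exact hm k h

theorem scott_of_mem {S : Set (Patch X)} {l : List (Nucleus X)} (hl : l ∈ Lists S) :
    ScottContinuous (comps l) :=
  comps_scott l fun k hk => by
    obtain ⟨j, _, rfl⟩ := hl k hk
    exact j.2

theorem join_scott (S : Set (Patch X)) :
    ScottContinuous (fun U : X => ⨆ l ∈ Lists S, comps l U) := by
  intro d hd hdir a ha
  constructor
  · rintro _ ⟨U, hU, rfl⟩
    exact iSup₂_mono fun l _ => comps_mono l (ha.1 hU)
  · intro b hb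
    refine iSup₂_le fun l hl => (scott_of_mem hl hd hdir ha).2 ?_
    rintro _ ⟨U, hU, rfl⟩
    exact (le_iSup₂ (f := fun l (_ : l ∈ Lists S) => comps l U) l hl).trans
      (hb ⟨U, hU, rfl⟩)

/-- The join of a set of Scott continuous nuclei: the pointwise join of all finite composites. -/
def join (S : Set (Patch X)) : Nucleus X where
  toFun U := ⨆ l ∈ Lists S, comps l U
  map_inf' U V := by
    apply le_antisymm
    · refine le_inf ?_ ?_
      · exact iSup₂_mono fun l _ => comps_mono l inf_le_left
      · exact iSup₂_mono fun l _ => comps_mono l inf_le_right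
    · rw [iSup₂_inf_eq]
      refine iSup₂_le fun l hl => ?_
      rw [inf_iSup₂_eq]
      refine iSup₂_le fun m hm => ?_
      refine le_trans ?_ (le_iSup₂ (l ++ m) (append_mem hl hm))
      rw [comps_inf, comps_append, comps_append]
      exact inf_le_inf (comps_mono l (le_comps m U)) (le_comps l _)
  idempotent' U := by
    refine iSup₂_le fun l hl => ?_
    have hne : ((fun m => comps m U) '' Lists S).Nonempty :=
      Set.Nonempty.image _ ⟨[], by intro k hk; simp at hk⟩
    have hdir : DirectedOn (· ≤ ·) ((fun m => comps m U) '' Lists S) := by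
      rintro _ ⟨m, hm, rfl⟩ _ ⟨n, hn, rfl⟩
      refine ⟨_, ⟨m ++ n, append_mem hm hn, rfl⟩, ?_, ?_⟩
      · change comps m U ≤ comps (m ++ n) U
        rw [comps_append]
        exact comps_mono m (le_comps n U)
      · change comps n U ≤ comps (m ++ n) U
        rw [comps_append]
        exact le_comps m _
    have hlub : IsLUB ((fun m => comps m U) '' Lists S) (⨆ m ∈ Lists S, comps m U) := by
      rw [← sSup_image]
      exact isLUB_sSup _
    refine (scott_of_mem hl hne hdir hlub).2 ?_
    rintro _ ⟨_, ⟨m, hm, rfl⟩, rfl⟩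
    change comps l (comps m U) ≤ _
    rw [← comps_append]
    exact le_iSup₂ (f := fun l (_ : l ∈ Lists S) => comps l U) (l ++ m) (append_mem hl hm)
  le_apply' U := le_iSup₂ (f := fun l (_ : l ∈ Lists S) => comps l U) []
    (by intro k hk; simp at hk)

theorem join_apply (S : Set (Patch X)) (U : X) : join S U = ⨆ l ∈ Lists S, comps l U := rfl

instance : SupSet (Patch X) := ⟨fun S => ⟨join S, join_scott S⟩⟩

theorem coe_sSup (S : Set (Patch X)) : (sSup S).1 = join S := rfl

theorem isLUB_join (S : Set (Patch X)) : IsLUB (Subtype.val '' S) (join S) := by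
  constructor
  · rintro _ ⟨j, hj, rfl⟩ U
    refine le_trans ?_ (le_iSup₂ (f := fun l (_ : l ∈ Lists S) => comps l U) [j.1] ?_)
    · exact le_rfl
    · intro k hk
      exact ⟨j, hj, (List.mem_singleton.1 hk).symm⟩
  · intro n hn U
    refine iSup₂_le fun l hl => comps_le ?_ U
    intro k hk
    obtain ⟨j, hj, rfl⟩ := hl k hk
    exact hn ⟨j, hj, rfl⟩

theorem scott_inf (j k : Patch X) : ScottContinuous (j.1 ⊓ k.1 : Nucleus X) := by
  intro d hd hdir a ha
  constructor
  · rintro _ ⟨U, hU, rfl⟩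
    exact (j.1 ⊓ k.1).monotone (ha.1 hU)
  · intro b hb
    rw [Nucleus.inf_apply, ← (j.2 hd hdir ha).sSup_eq, ← (k.2 hd hdir ha).sSup_eq, sSup_inf_sSup]
    refine iSup₂_le ?_
    rintro ⟨_, _⟩ ⟨⟨U, hU, rfl⟩, ⟨V, hV, rfl⟩⟩
    obtain ⟨W, hW, hUW, hVW⟩ := hdir U hU V hV
    exact (inf_le_inf (j.1.monotone hUW) (k.1.monotone hVW)).trans (hb ⟨W, hW, rfl⟩)

theorem scott_top : ScottContinuous (⊤ : Nucleus X) := by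
  intro d hd _ a _
  have : (⇑(⊤ : Nucleus X)) '' d = {⊤} := by
    ext x
    simp only [Set.mem_image, Nucleus.top_apply, Set.mem_singleton_iff]
    exact ⟨fun ⟨_, _, h⟩ => h.symm, fun h => ⟨_, hd.some_mem, h.symm⟩⟩
  rw [this]
  exact isLUB_singleton

instance : CompleteLattice (Patch X) where
  __ := completeLatticeOfSup (Patch X) fun S =>
    ⟨fun j hj => (isLUB_join S).1 ⟨j, hj, rfl⟩, fun n hn => (isLUB_join S).2 (by
      rintro _ ⟨j, hj, rfl⟩
      exact hn hj)⟩
  inf j k := ⟨j.1 ⊓ k.1, scott_inf j k⟩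
  inf_le_left j k := (inf_le_left : j.1 ⊓ k.1 ≤ j.1)
  inf_le_right j k := (inf_le_right : j.1 ⊓ k.1 ≤ k.1)
  le_inf i j k h1 h2 := (le_inf h1 h2 : i.1 ≤ j.1 ⊓ k.1)
  top := ⟨⊤, scott_top⟩
  le_top j := (le_top : j.1 ≤ ⊤)

theorem coe_inf (j k : Patch X) : (j ⊓ k).1 = j.1 ⊓ k.1 := rfl

theorem coe_top : (⊤ : Patch X).1 = ⊤ := rfl

instance : Order.Frame (Patch X) :=
  .ofMinimalAxioms
    { inf_sSup_le_iSup_inf := fun j S => by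
        change j.1 ⊓ join S ≤ (⨆ k ∈ S, j ⊓ k : Patch X).1
        rw [← (isLUB_join S).sSup_eq, inf_sSup_eq]
        refine iSup₂_le ?_
        rintro _ ⟨k, hk, rfl⟩
        exact le_iSup₂ (f := fun k (_ : k ∈ S) => (j ⊓ k : Patch X)) k hk }

/-- The closed nucleus `V ↦ U ⊔ V` of an open `U`. -/
def closed (U : X) : Patch X :=
  ⟨{ toFun := fun V => U ⊔ V
     map_inf' := fun V W => sup_inf_left U V W
     idempotent' := fun V => by simp
     le_apply' := fun V => le_sup_right }, by
    intro d hd _ a ha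
    constructor
    · rintro _ ⟨V, hV, rfl⟩
      exact sup_le_sup_left (ha.1 hV) U
    · intro b hb
      obtain ⟨V, hV⟩ := hd
      refine sup_le (le_sup_left.trans (hb ⟨V, hV, rfl⟩)) (ha.2 fun W hW => ?_)
      exact le_sup_right.trans (hb ⟨W, hW, rfl⟩)⟩

theorem closed_apply (U V : X) : (closed U).1 V = U ⊔ V := rfl

end Patch

/-- The counit `ε : Patch X → X`, whose inverse image sends an open to its closed nucleus. -/
def patchCounit (X : Type u) [Order.Frame X] : FrameHom X (Patch X) where
  toFun := Patch.closed
  map_inf' U V := Subtype.ext <| Nucleus.ext fun W => sup_inf_right U V W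
  map_top' := Subtype.ext <| Nucleus.ext fun W => top_sup_eq W
  map_sSup' S := by
    apply le_antisymm
    · intro V
      refine sup_le (sSup_le fun U hU => ?_) (Nucleus.le_apply)
      have h : Patch.closed U ≤ sSup (Patch.closed '' S) := le_sSup ⟨U, hU, rfl⟩
      exact le_sup_left.trans (h V)
    · refine sSup_le ?_
      rintro _ ⟨U, hU, rfl⟩ V
      exact sup_le_sup_right (le_sSup hU) V

/-- `ε : P → X` exhibits `P` as a patch locale of `X`: `P` is Stone, `ε` is spectral, and every
spectral map `f` from a Stone locale `A` to `X` factors as `ε ∘ g` for a unique continuous map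
`g : A → P`. -/
structure IsPatchOf {X P : Type u} [Order.Frame X] [Order.Frame P] (ε : FrameHom X P) : Prop where
  stone : IsStoneLocale P
  spectral : IsSpectralHom ε
  existsUnique_lift : ∀ (A : Type u) [Order.Frame A], IsStoneLocale A →
    ∀ f : FrameHom X A, IsSpectralHom f → ∃! g : FrameHom P A, g.comp ε = f

end Patch

end PointFree

open PointFree

universe v

namespace PointFree

/-! ## Compact elements and bases -/

/-! In a spectral locale the closed nucleus of a compact open `K` is complemented by `V ↦ K ⇨ V`,
which is Scott continuous because compact opens are closed under binary meets. Every Scott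
continuous nucleus is a join of meets of closed nuclei with such complements
(`le_sSup_closed_inf_open`), and the top nucleus is compact, so the patch is Stone. Since frame
homomorphisms preserve complements, the same generation makes lifts unique (`hom_ext`). They exist
because `j ↦ ⨆ K, f (j K) ⊓ (f K)ᶜ`, over compact `K`, is left adjoint to `a ↦ f_* (a ⊔ f -)`
(`gc_liftFun`), hence preserves joins; finite meets are checked directly.

Classically every proposition is compact and complemented, so every point is spectral and lifts
along the counit. For a Scott domain, principal opens of finite elements generate the Scott
topology, and a pair of them meets in a principal or an empty open, which gives spectrality.
Algebraicity makes every point the point of a unique element (`pointOf_surjective`), and excluded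
middle makes every element sharp. -/

/-- Joining with the complement `b` turns a directed cover of `a` into one of `⊤`; if `x ⊔ b = ⊤`
then `a ≤ x`, as `a` is disjoint from `b`. -/
theorem isCompactElement_of_isComplemented {X : Type u} [Order.Frame X]
    (htop : IsCompactElement (⊤ : X)) {a : X} (ha : IsComplemented a) : IsCompactElement a := by
  obtain ⟨b, hb⟩ := ha
  rw [CompleteLattice.isCompactElement_iff_le_of_directed_sSup_le] at htop ⊢
  intro s hs hdir hle
  have hmono : Monotone fun x : X => x ⊔ b := fun x y h => sup_le_sup_right h b
  obtain ⟨_, ⟨x, hx, rfl⟩, hxb⟩ := htop ((fun x => x ⊔ b) '' s) (hs.image _)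
    (hdir.mono_comp hmono) (by
      rw [← hb.sup_eq_top]
      refine sup_le (hle.trans (sSup_le fun x hx => ?_)) ?_
      · exact le_sup_left.trans (le_sSup ⟨x, hx, rfl⟩)
      · obtain ⟨x, hx⟩ := hs
        exact le_sup_right.trans (le_sSup ⟨x, hx, rfl⟩))
  exact ⟨x, hx, hb.disjoint.le_of_codisjoint (codisjoint_iff_le_sup.2 (hxb.trans (sup_comm x b).le))⟩

/-- A compact open lies below one member of the directed family whose join it is. Properties of a
base thus pass to all compact opens. -/
theorem IsBase.exists_eq {X : Type u} [Order.Frame X] {ι : Type u} {B : ι → X} (hB : IsBase B)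
    {K : X} (hK : IsCompactElement K) : ∃ i, B i = K := by
  obtain ⟨s, hs, hdir, hU⟩ := hB K
  obtain ⟨_, ⟨i, hi, rfl⟩, h⟩ := hK (B '' s) K (hs.image _) (by
    rintro _ ⟨i, hi, rfl⟩ _ ⟨j, hj, rfl⟩
    obtain ⟨k, hk, h1, h2⟩ := hdir i hi j hj
    exact ⟨_, ⟨k, hk, rfl⟩, h1, h2⟩) (by
    rw [isLUB_iff_sSup_eq, sSup_image, ← hU]) le_rfl
  refine ⟨i, le_antisymm ?_ h⟩
  rw [hU]
  exact le_iSup₂ (f := fun i (_ : i ∈ s) => B i) i hi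

theorem IsBase.isCompactlyGenerated {X : Type u} [Order.Frame X] {ι : Type u} {B : ι → X}
    (hB : IsBase B) (hc : ∀ i, IsCompactElement (B i)) : IsCompactlyGenerated X := by
  refine ⟨fun U => ?_⟩
  obtain ⟨s, -, -, hU⟩ := hB U
  refine ⟨B '' s, ?_, ?_⟩
  · rintro _ ⟨i, -, rfl⟩
    exact hc i
  · rw [sSup_image, ← hU]

/-- A family containing `⊥`, closed under binary joins, and generating under joins is a base. -/
theorem isBase_subtype {X : Type u} [Order.Frame X] {P : X → Prop} (hbot : P ⊥)
    (hsup : ∀ U V, P U → P V → P (U ⊔ V)) (hgen : ∀ U, U ≤ sSup {V | P V ∧ V ≤ U}) :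
    IsBase (Subtype.val : {U : X // P U} → X) := by
  intro U
  refine ⟨{V | V.1 ≤ U}, ⟨⟨⊥, hbot⟩, bot_le⟩, ?_, ?_⟩
  · intro V hV W hW
    exact ⟨⟨V.1 ⊔ W.1, hsup _ _ V.2 W.2⟩, sup_le hV hW, le_sup_left, le_sup_right⟩
  · apply le_antisymm
    · refine (hgen U).trans (sSup_le fun V hV => ?_)
      exact le_iSup₂ (f := fun (V : {U : X // P U}) (_ : V ∈ {V : {U : X // P U} | V.1 ≤ U}) => V.1)
        ⟨V, hV.1⟩ hV.2
    · exact iSup₂_le fun V hV => hV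

theorem isCompactElement_sup {X : Type u} [CompleteLattice X] {K L : X} (hK : IsCompactElement K)
    (hL : IsCompactElement L) : IsCompactElement (K ⊔ L) := by
  classical
  have := CompleteLattice.isCompactElement_finsetSup (f := id) ({K, L} : Finset X) (by
    intro x hx
    rcases Finset.mem_insert.1 hx with rfl | hx
    · exact hK
    · rw [Finset.mem_singleton.1 hx]; exact hL)
  simpa using this

theorem isCompactElement_bot {X : Type u} [CompleteLattice X] : IsCompactElement (⊥ : X) :=
  fun _ _ hs _ _ _ => ⟨_, hs.some_mem, bot_le⟩

theorem isSpectralLocale_iff {X : Type u} [Order.Frame X] :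
    IsSpectralLocale X ↔ IsCompactlyGenerated X ∧ IsCompactElement (⊤ : X) ∧
      ∀ K L : X, IsCompactElement K → IsCompactElement L → IsCompactElement (K ⊓ L) := by
  constructor
  · rintro ⟨ι, B, hB, hc, ⟨i, hi⟩, hinf⟩
    refine ⟨hB.isCompactlyGenerated hc, hi ▸ hc i, fun K L hK hL => ?_⟩
    obtain ⟨k, rfl⟩ := hB.exists_eq hK
    obtain ⟨l, rfl⟩ := hB.exists_eq hL
    obtain ⟨m, hm⟩ := hinf k l
    exact hm ▸ hc m
  · rintro ⟨hX, htop, hinf⟩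
    refine ⟨_, _, isBase_subtype isCompactElement_bot (fun _ _ => isCompactElement_sup)
      fun U => (sSup_compact_le_eq U).ge, Subtype.prop, ⟨⟨⊤, htop⟩, rfl⟩, fun K L =>
      ⟨⟨K.1 ⊓ L.1, hinf _ _ K.2 L.2⟩, rfl⟩⟩

theorem IsSpectralLocale.isCompactlyGenerated {X : Type u} [Order.Frame X]
    (hX : IsSpectralLocale X) : IsCompactlyGenerated X :=
  (isSpectralLocale_iff.1 hX).1

theorem IsSpectralLocale.isCompactElement_top {X : Type u} [Order.Frame X]
    (hX : IsSpectralLocale X) : IsCompactElement (⊤ : X) :=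
  (isSpectralLocale_iff.1 hX).2.1

theorem IsSpectralLocale.isCompactElement_inf {X : Type u} [Order.Frame X]
    (hX : IsSpectralLocale X) {K L : X} (hK : IsCompactElement K) (hL : IsCompactElement L) :
    IsCompactElement (K ⊓ L) :=
  (isSpectralLocale_iff.1 hX).2.2 K L hK hL

theorem isStoneLocale_of {X : Type u} [Order.Frame X] (htop : IsCompactElement (⊤ : X))
    (hgen : ∀ U : X, U ≤ sSup {V | IsComplemented V ∧ V ≤ U}) : IsStoneLocale X :=
  ⟨_, _, isBase_subtype isComplemented_bot (fun _ _ => IsComplemented.sup) hgen,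
    fun i => isCompactElement_of_isComplemented htop i.2, ⟨⟨⊤, isComplemented_top⟩, rfl⟩,
    Subtype.prop⟩

theorem IsStoneLocale.isComplemented {X : Type u} [Order.Frame X] (hX : IsStoneLocale X) {K : X}
    (hK : IsCompactElement K) : IsComplemented K := by
  obtain ⟨ι, B, hB, -, -, hcl⟩ := hX
  obtain ⟨i, rfl⟩ := hB.exists_eq hK
  exact hcl i

/-- A true `p` below the join forces some member to be true; a false `p` is below any member. The
spectrality condition on points is therefore vacuous. -/
theorem isCompactElement_prop (p : Prop) : IsCompactElement p := by
  rw [CompleteLattice.isCompactElement_iff_le_of_directed_sSup_le]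
  intro s hs _ hle
  by_cases hp : p
  · obtain ⟨q, hq, h⟩ := hle hp
    exact ⟨q, hq, fun _ => h⟩
  · exact ⟨_, hs.some_mem, fun h => (hp h).elim⟩

theorem isSpectralHom_point {X : Type u} [Order.Frame X] (p : Pt X) : IsSpectralHom p :=
  fun K _ => isCompactElement_prop (p K)

/-! ## The patch locale of a spectral locale -/

namespace Patch

variable {X : Type u} [Order.Frame X]

theorem exists_mem_forall_le {S : Set (Patch X)} (hS : S.Nonempty) (hdir : DirectedOn (· ≤ ·) S) :
    ∀ l ∈ Lists S, ∃ j ∈ S, ∀ k ∈ l, k ≤ j.1 := by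
  intro l
  induction l with
  | nil => exact fun _ => ⟨_, hS.some_mem, by simp⟩
  | cons k l ih =>
    intro hl
    obtain ⟨i, hi, hil⟩ := ih fun m hm => hl m (List.mem_cons_of_mem _ hm)
    obtain ⟨i', hi', rfl⟩ := hl k List.mem_cons_self
    obtain ⟨j, hj, h1, h2⟩ := hdir i hi i' hi'
    refine ⟨j, hj, fun m hm => ?_⟩
    rcases List.mem_cons.1 hm with rfl | hm
    · exact h2
    · exact (hil m hm).trans h1

/-- Directedness bounds the nuclei in a finite composite by a single member, which absorbs the
composite by idempotence; so directed joins are computed pointwise. -/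
theorem sSup_apply_of_directedOn {S : Set (Patch X)} (hS : S.Nonempty)
    (hdir : DirectedOn (· ≤ ·) S) (U : X) : (sSup S).1 U ≤ sSup ((fun j : Patch X => j.1 U) '' S) := by
  rw [coe_sSup, join_apply]
  refine iSup₂_le fun l hl => ?_
  obtain ⟨j, hj, h⟩ := exists_mem_forall_le hS hdir l hl
  exact (comps_le h U).trans (le_sSup ⟨j, hj, rfl⟩)

/-- A nucleus is top as soon as it sends `⊥` to `⊤`, so evaluation at `⊥` reduces the claim to
compactness of `⊤` in `X`. -/
theorem isCompactElement_top (htop : IsCompactElement (⊤ : X)) :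
    IsCompactElement (⊤ : Patch X) := by
  rw [CompleteLattice.isCompactElement_iff_le_of_directed_sSup_le] at htop ⊢
  intro S hS hdir hle
  obtain ⟨_, ⟨j, hj, rfl⟩, h⟩ := htop ((fun j : Patch X => j.1 ⊥) '' S) (hS.image _)
    (hdir.mono_comp fun i j (h : i ≤ j) => h ⊥)
    ((hle ⊥).trans (sSup_apply_of_directedOn hS hdir ⊥))
  exact ⟨j, hj, fun U => h.trans (j.1.monotone bot_le)⟩

/-- The open nucleus `V ↦ (K ⇨ V)` of an open `K`. -/
def openNucleus (K : X) : Nucleus X where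
  toFun V := K ⇨ V
  map_inf' V W := himp_inf_distrib K V W
  idempotent' V := by simp
  le_apply' V := le_himp

theorem openNucleus_scottContinuous (hX : IsSpectralLocale X) {K : X}
    (hK : IsCompactElement K) : ScottContinuous (openNucleus K) := by
  have := hX.isCompactlyGenerated
  intro d hd hdir a ha
  constructor
  · rintro _ ⟨V, hV, rfl⟩
    exact (openNucleus K).monotone (ha.1 hV)
  · intro b hb
    refine le_iff_compact_le_imp.2 fun L hL hLK => ?_
    -- By adjunction `L ≤ K ⇨ a` means `L ⊓ K ≤ a`, and `L ⊓ K` is compact.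
    obtain ⟨V, hV, h⟩ := hX.isCompactElement_inf hL hK d a hd hdir ha (le_himp_iff.1 hLK)
    exact (le_himp_iff.2 h).trans (hb ⟨V, hV, rfl⟩)

theorem isCompl_closed_of_coe_eq {K : X} {o : Patch X} (ho : o.1 = openNucleus K) :
    IsCompl (closed K) o := by
  refine .of_le (fun V => ?_) fun V => ?_
  · change (K ⊔ V) ⊓ o.1 V ≤ (⊥ : Patch X).1 V
    refine le_trans ?_ (⊥ : Patch X).1.le_apply
    rw [ho, inf_sup_right]
    exact sup_le inf_himp_le inf_le_left
  · have h1 : closed K ≤ closed K ⊔ o := le_sup_left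
    have h2 : o ≤ closed K ⊔ o := le_sup_right
    have h3 : K ≤ (closed K ⊔ o).1 V := le_sup_left.trans (h1 V)
    -- Write `m` for the join. Then `K ⇨ m V ≤ m (m V) = m V`, and the left side is `⊤` since `K ≤ m
    -- V`.
    have h4 := h2 ((closed K ⊔ o).1 V)
    rw [ho, Nucleus.idempotent] at h4
    refine le_trans ?_ h4
    exact le_himp_iff.2 (inf_le_right.trans h3)

/-- A Scott continuous nucleus on a compactly generated frame is below `k` as soon as it is so on
compact elements. -/
theorem le_of_forall_compact [IsCompactlyGenerated X] {j k : Patch X}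
    (h : ∀ K : X, IsCompactElement K → j.1 K ≤ k.1 K) : j ≤ k := by
  intro V
  have hlub : IsLUB {K : X | IsCompactElement K ∧ K ≤ V} V := by
    rw [isLUB_iff_sSup_eq, sSup_compact_le_eq]
  have hne : {K : X | IsCompactElement K ∧ K ≤ V}.Nonempty := ⟨⊥, isCompactElement_bot, bot_le⟩
  refine (j.2 hne ?_ hlub).2 ?_
  · rintro K ⟨hK, hKV⟩ L ⟨hL, hLV⟩
    exact ⟨K ⊔ L, ⟨isCompactElement_sup hK hL, sup_le hKV hLV⟩, le_sup_left, le_sup_right⟩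
  · rintro _ ⟨K, ⟨hK, hKV⟩, rfl⟩
    exact (h K hK).trans (k.1.monotone hKV)

theorem isComplemented_closed (hX : IsSpectralLocale X) {K : X} (hK : IsCompactElement K) :
    IsComplemented (closed K) :=
  ⟨⟨openNucleus K, openNucleus_scottContinuous hX hK⟩, isCompl_closed_of_coe_eq rfl⟩

/-- For compact `L ≤ j K`, the nucleus `V ↦ (L ⊔ V) ⊓ (K ⇨ V)` is below `j`, and its value at `K` is
above `L`. Describing the open part only as a complement is what lets homomorphisms be compared on
it. -/
theorem le_sSup_closed_inf_open (hX : IsSpectralLocale X) (j : Patch X) :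
    j ≤ sSup {k | (∃ K L : X, IsCompactElement K ∧ IsCompactElement L ∧
      ∃ o, IsCompl (closed K) o ∧ k = closed L ⊓ o) ∧ k ≤ j} := by
  have := hX.isCompactlyGenerated
  refine le_of_forall_compact fun K hK => le_iff_compact_le_imp.2 fun L hL hLK => ?_
  let o : Patch X := ⟨openNucleus K, openNucleus_scottContinuous hX hK⟩
  have hle : closed L ⊓ o ≤ j := by
    intro V
    change (L ⊔ V) ⊓ (K ⇨ V) ≤ j.1 V
    rw [inf_sup_right]
    refine sup_le ?_ (inf_le_left.trans j.1.le_apply)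
    calc L ⊓ (K ⇨ V) ≤ j.1 K ⊓ j.1 (K ⇨ V) := inf_le_inf hLK j.1.le_apply
      _ = j.1 (K ⊓ (K ⇨ V)) := (j.1.map_inf).symm
      _ ≤ j.1 V := j.1.monotone inf_himp_le
  have hmem : closed L ⊓ o ≤ sSup {k | (∃ K L : X, IsCompactElement K ∧ IsCompactElement L ∧
      ∃ o, IsCompl (closed K) o ∧ k = closed L ⊓ o) ∧ k ≤ j} :=
    le_sSup ⟨⟨K, L, hK, hL, o, isCompl_closed_of_coe_eq rfl, rfl⟩, hle⟩
  refine le_trans ?_ (hmem K)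
  change L ≤ (L ⊔ K) ⊓ (K ⇨ K)
  simp

theorem isStoneLocale (hX : IsSpectralLocale X) : IsStoneLocale (Patch X) := by
  refine isStoneLocale_of (isCompactElement_top hX.isCompactElement_top) fun j => ?_
  refine (le_sSup_closed_inf_open hX j).trans (sSup_le_sSup ?_)
  rintro _ ⟨⟨K, L, hK, hL, o, ho, rfl⟩, h⟩
  exact ⟨(isComplemented_closed hX hL).inf ⟨_, ho.symm⟩, h⟩

theorem isSpectralHom_patchCounit (hX : IsSpectralLocale X) : IsSpectralHom (patchCounit X) :=
  fun _ hK => isCompactElement_of_isComplemented (isCompactElement_top hX.isCompactElement_top)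
    (isComplemented_closed hX hK)

/-! ## The universal property -/

variable {A : Type v} [Order.Frame A]

/-- A frame homomorphism out of the patch frame is determined by its composite with the counit. -/
theorem hom_ext (hX : IsSpectralLocale X) {g h : FrameHom (Patch X) A}
    (hgh : g.comp (patchCounit X) = h.comp (patchCounit X)) : g = h := by
  have hc (U : X) : g (closed U) = h (closed U) := DFunLike.congr_fun hgh U
  have key (g h : FrameHom (Patch X) A) (hc : ∀ U, g (closed U) = h (closed U)) (j : Patch X) :
      g j ≤ h j := by
    refine (OrderHomClass.mono g (le_sSup_closed_inf_open hX j)).trans ?_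
    rw [map_sSup]
    refine sSup_le ?_
    rintro _ ⟨_, ⟨⟨K, L, -, -, o, ho, rfl⟩, hj⟩, rfl⟩
    refine le_trans (le_of_eq ?_) (OrderHomClass.mono h hj)
    -- Agreement on closed nuclei extends to their complements, which are preserved and unique.
    have h1 : IsCompl (h (closed K)) (g o) := hc K ▸ ho.map g
    rw [map_inf, map_inf, hc, h1.right_unique (ho.map h)]
  exact DFunLike.ext _ _ fun j => le_antisymm (key g h hc j) (key h g (fun U => (hc U).symm) j)

/-- The right adjoint of a frame homomorphism. -/
def rightAdjoint (f : FrameHom X A) (a : A) : X := sSup {U | f U ≤ a}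

theorem gc_rightAdjoint (f : FrameHom X A) : GaloisConnection f (rightAdjoint f) := by
  intro U a
  constructor
  · exact fun h => le_sSup h
  · intro h
    refine (OrderHomClass.mono f h).trans ?_
    rw [rightAdjoint, map_sSup]
    refine sSup_le ?_
    rintro _ ⟨V, hV, rfl⟩
    exact hV

/-- The nucleus `U ↦ f_* (a ⊔ f U)`. -/
def pushNucleus (f : FrameHom X A) (a : A) : Nucleus X where
  toFun U := rightAdjoint f (a ⊔ f U)
  map_inf' U V := by
    rw [map_inf, sup_inf_left, (gc_rightAdjoint f).u_inf]
  idempotent' U := (gc_rightAdjoint f).monotone_u <|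
    sup_le le_sup_left ((gc_rightAdjoint f).l_u_le _)
  le_apply' U := (gc_rightAdjoint f).le_u le_sup_right

theorem pushNucleus_scottContinuous [IsCompactlyGenerated X] {f : FrameHom X A}
    (hf : IsSpectralHom f) (a : A) : ScottContinuous (pushNucleus f a) := by
  intro d hd hdir b hb
  constructor
  · rintro _ ⟨V, hV, rfl⟩
    exact (pushNucleus f a).monotone (hb.1 hV)
  · intro c hc
    refine le_iff_compact_le_imp.2 fun K hK hle => ?_
    have hle' : f K ≤ a ⊔ f b := (gc_rightAdjoint f).l_le hle
    have hmono : Monotone fun V => a ⊔ f V := fun V W h =>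
      sup_le_sup_left (OrderHomClass.mono f h) a
    have hs : f K ≤ sSup ((fun V => a ⊔ f V) '' d) := by
      refine hle'.trans (sup_le ?_ ?_)
      · exact le_sup_left.trans (le_sSup ⟨_, hd.some_mem, rfl⟩)
      · rw [← hb.sSup_eq, map_sSup]
        refine sSup_le ?_
        rintro _ ⟨V, hV, rfl⟩
        exact le_sup_right.trans (le_sSup ⟨V, hV, rfl⟩)
    -- Spectrality of `f` enters here: `f K` is compact and covered by the directed family `a ⊔ f
    -- V`.
    obtain ⟨_, ⟨V, hV, rfl⟩, h⟩ := hf K hK _ _ (hd.image _) (hdir.mono_comp hmono)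
      (isLUB_sSup _) hs
    exact ((gc_rightAdjoint f).le_u h).trans (hc ⟨V, hV, rfl⟩)

/-- The underlying function of the lift of `f` to the patch frame. -/
def liftFun (f : FrameHom X A) (j : Patch X) : A :=
  ⨆ K : {K : X // IsCompactElement K}, f (j.1 K.1) ⊓ (f K.1)ᶜ

/-- As `f K` is complemented, `f (j K) ⊓ (f K)ᶜ ≤ a` means `f (j K) ≤ a ⊔ f K`, that is, `j K ≤ f_*
(a ⊔ f K)`. Scott continuity of `j` makes it enough to test compact `K`. -/
theorem gc_liftFun [IsCompactlyGenerated X] {f : FrameHom X A} (hf : IsSpectralHom f)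
    (hc : ∀ K, IsCompactElement K → IsComplemented (f K)) :
    GaloisConnection (liftFun f)
      fun a => (⟨pushNucleus f a, pushNucleus_scottContinuous hf a⟩ : Patch X) := by
  intro j a
  have h (K : X) (hK : IsCompactElement K) :
      f (j.1 K) ⊓ (f K)ᶜ ≤ a ↔ j.1 K ≤ pushNucleus f a K := by
    have hb : IsCompl (f K) (f K)ᶜ := by
      obtain ⟨b, hb⟩ := hc K hK
      rwa [hb.compl_eq]
    refine Iff.trans ?_ (gc_rightAdjoint f _ _)
    constructor
    · intro h
      calc f (j.1 K) = f (j.1 K) ⊓ (f K ⊔ (f K)ᶜ) := by rw [hb.sup_eq_top, inf_top_eq]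
        _ ≤ a ⊔ f K := by
          rw [inf_sup_left]
          exact sup_le (inf_le_right.trans le_sup_right) (h.trans le_sup_left)
    · intro h
      refine (inf_le_inf_right _ h).trans ?_
      rw [inf_sup_right, inf_compl_self, sup_bot_eq]
      exact inf_le_left
  refine iSup_le_iff.trans ⟨fun hle => le_of_forall_compact fun K hK => ?_, fun hle K => ?_⟩
  · exact (h K hK).1 (hle ⟨K, hK⟩)
  · exact (h K.1 K.2).2 (hle K.1)

/-- The lift of a spectral map with complemented inverse images of compact opens. -/
def lift [IsCompactlyGenerated X] (f : FrameHom X A) (hf : IsSpectralHom f)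
    (hc : ∀ K, IsCompactElement K → IsComplemented (f K)) : FrameHom (Patch X) A where
  toFun := liftFun f
  map_inf' j k := by
    have hm := (gc_liftFun hf hc).monotone_l
    refine le_antisymm (le_inf (hm inf_le_left) (hm inf_le_right)) ?_
    rw [liftFun, liftFun, iSup_inf_iSup]
    refine iSup_le fun ⟨⟨K, hK⟩, ⟨L, hL⟩⟩ => ?_
    -- The terms at `K` and `L` meet below the term at `K ⊔ L`.
    refine le_trans ?_ (le_iSup (fun K : {K : X // IsCompactElement K} =>
      f ((j ⊓ k).1 K.1) ⊓ (f K.1)ᶜ) ⟨K ⊔ L, isCompactElement_sup hK hL⟩)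
    simp only [coe_inf, Nucleus.inf_apply, map_inf, map_sup, compl_sup]
    rw [inf_inf_inf_comm]
    exact inf_le_inf_right _ (inf_le_inf
      (OrderHomClass.mono f (j.1.monotone le_sup_left))
      (OrderHomClass.mono f (k.1.monotone le_sup_right)))
  map_top' := top_le_iff.1 <| le_trans (by simp [coe_top]) (le_iSup (fun K : {K : X //
    IsCompactElement K} => f ((⊤ : Patch X).1 K.1) ⊓ (f K.1)ᶜ) ⟨⊥, isCompactElement_bot⟩)
  map_sSup' S := by
    rw [(gc_liftFun hf hc).l_sSup, sSup_image]

/-- Each term is `f (U ⊔ K) ⊓ (f K)ᶜ ≤ f U`, and the term at `K = ⊥` attains `f U`. -/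
theorem lift_comp_patchCounit [IsCompactlyGenerated X] (f : FrameHom X A) (hf : IsSpectralHom f)
    (hc : ∀ K, IsCompactElement K → IsComplemented (f K)) :
    (lift f hf hc).comp (patchCounit X) = f := by
  refine DFunLike.ext _ _ fun U => le_antisymm (iSup_le fun K => ?_) ?_
  · change f (U ⊔ K.1) ⊓ (f K.1)ᶜ ≤ f U
    rw [map_sup, inf_sup_right, inf_compl_self, sup_bot_eq]
    exact inf_le_left
  · refine le_trans ?_ (le_iSup (fun K : {K : X // IsCompactElement K} =>
      f ((closed U).1 K.1) ⊓ (f K.1)ᶜ) ⟨⊥, isCompactElement_bot⟩)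
    simp [closed_apply]

end Patch

theorem isPatchOf_patchCounit {X : Type u} [Order.Frame X] (hX : IsSpectralLocale X) :
    IsPatchOf (patchCounit X) where
  stone := Patch.isStoneLocale hX
  spectral := Patch.isSpectralHom_patchCounit hX
  existsUnique_lift A _ hA f hf := by
    have := hX.isCompactlyGenerated
    exact ⟨Patch.lift f hf fun K hK => hA.isComplemented (hf K hK),
      Patch.lift_comp_patchCounit f hf _,
      fun g hg => Patch.hom_ext hX (hg.trans (Patch.lift_comp_patchCounit f hf _).symm)⟩

/-- Every point is spectral, so that spectral points are the same as points. -/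
def specPtEquivPt (X : Type u) [Order.Frame X] : SpecPt X ≃ Pt X where
  toFun := Subtype.val
  invFun p := ⟨p, isSpectralHom_point p⟩
  left_inv _ := rfl
  right_inv _ := rfl

theorem exists_specPt_equiv {X : Type u} [Order.Frame X] (hX : IsSpectralLocale X) :
    ∃ (e₂ : SpecPt X ≃ SpecPt (Patch X)) (e₃ : SpecPt (Patch X) ≃ Pt (Patch X)),
      (∀ p, (e₂ p).1.comp (patchCounit X) = p.1) ∧ (∀ p, e₃ p = p.1) := by
  have := hX.isCompactlyGenerated
  -- The lift is applied directly to `Prop`, whose universe may differ from that of `X`; it needs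
  -- only complements, and `Prop` is Boolean.
  have hl (p : SpecPt X) : ∃ q : Pt (Patch X), q.comp (patchCounit X) = p.1 :=
    ⟨_, Patch.lift_comp_patchCounit p.1 p.2 fun K _ => ComplementedLattice.exists_isCompl _⟩
  choose l hl using hl
  exact ⟨{  toFun := fun p => ⟨l p, isSpectralHom_point _⟩
            invFun := fun q => ⟨q.1.comp (patchCounit X), isSpectralHom_point _⟩
            left_inv := fun p => Subtype.ext (hl p)
            right_inv := fun q => Subtype.ext (Patch.hom_ext hX (hl _)) },
    specPtEquivPt _, hl, fun _ => rfl⟩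


/-! ## Scott locales of Scott domains -/

section ScottDomain

open Topology

variable {D : Type u} [PartialOrder D]

theorem scottLocale_mem_of_le (U : ScottLocale D) {x y : D} (h : x ≤ y)
    (hx : WithScott.toScott x ∈ U) : WithScott.toScott y ∈ U :=
  IsScott.isUpperSet_of_isOpen (α := WithScott D) (D := Set.univ) U.isOpen h hx

theorem scottLocale_exists_mem (U : ScottLocale D) {s : Set D} (hs : s.Nonempty)
    (hdir : DirectedOn (· ≤ ·) s) {x : D} (hx : IsLUB s x) (hU : WithScott.toScott x ∈ U) :
    ∃ c ∈ s, WithScott.toScott c ∈ U :=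
  ((IsScott.isOpen_iff_isUpperSet_and_dirSupInaccOn (α := WithScott D) (D := Set.univ)).1
    U.isOpen).2 (Set.mem_univ s) hs hdir hx hU

/-- The principal Scott open `{x | c ≤ x}` of a finite element `c`. -/
def principalOpen (c : {c : D // IsCompactElement c}) : ScottLocale D where
  carrier := {x | c.1 ≤ WithScott.ofScott x}
  is_open' := by
    rw [IsScott.isOpen_iff_isUpperSet_and_dirSupInaccOn (D := Set.univ)]
    refine ⟨fun x y h hx => le_trans (b := WithScott.ofScott x) hx h, ?_⟩
    intro d _ hd hdir a ha hca
    obtain ⟨x, hx, h⟩ := c.2 d (WithScott.ofScott a) hd hdir ha hca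
    exact ⟨x, hx, h⟩

theorem mem_principalOpen {c : {c : D // IsCompactElement c}} {x : D} :
    WithScott.toScott x ∈ principalOpen c ↔ c.1 ≤ x := Iff.rfl

theorem principalOpen_le_iff {c : {c : D // IsCompactElement c}} {U : ScottLocale D} :
    principalOpen c ≤ U ↔ WithScott.toScott c.1 ∈ U :=
  ⟨fun h => h (mem_principalOpen.2 le_rfl), fun h _ hx => scottLocale_mem_of_le U hx h⟩

/-- An open contains the principal open of `c` as soon as it contains `c`, so the member of a cover
containing `c` suffices. -/
theorem isCompactElement_principalOpen (c : {c : D // IsCompactElement c}) :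
    IsCompactElement (principalOpen c) := by
  rw [CompleteLattice.isCompactElement_iff_le_of_directed_sSup_le]
  intro s _ _ hle
  obtain ⟨U, hU, h⟩ := TopologicalSpace.Opens.mem_sSup.1 (principalOpen_le_iff.1 hle)
  exact ⟨U, hU, principalOpen_le_iff.2 h⟩

variable (hD : IsScottDomain D)
include hD

theorem IsScottDomain.eq_iSup_principalOpen (U : ScottLocale D) :
    U = ⨆ c : {c : {c : D // IsCompactElement c} // WithScott.toScott c.1 ∈ U},
      principalOpen c.1 := by
  refine le_antisymm (fun x hx => ?_) (iSup_le fun c => principalOpen_le_iff.2 c.2)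
  obtain ⟨c, ⟨hc, hcx⟩, hcU⟩ := scottLocale_exists_mem U (hD.nonempty_below _)
    (hD.directedOn_below _) (hD.isLUB_below (WithScott.ofScott x)) hx
  exact TopologicalSpace.Opens.mem_iSup.2 ⟨⟨⟨c, hc⟩, hcU⟩, hcx⟩

theorem IsScottDomain.isCompactlyGenerated : IsCompactlyGenerated (ScottLocale D) := by
  refine ⟨fun U => ⟨_, ?_, (hD.eq_iSup_principalOpen U).symm⟩⟩
  rintro _ ⟨c, rfl⟩
  exact isCompactElement_principalOpen c.1

theorem IsScottDomain.exists_principalOpen_eq_top :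
    ∃ c : {c : D // IsCompactElement c}, principalOpen c = ⊤ := by
  obtain ⟨b, hb⟩ := hD.pointed
  exact ⟨⟨b, fun s _ hs _ _ _ => ⟨_, hs.some_mem, hb _⟩⟩, top_le_iff.1 fun x _ => hb _⟩

/-- Principal opens of finite elements meet in the empty open or in a principal open. -/
theorem IsScottDomain.isCompactElement_principalOpen_inf (c d : {c : D // IsCompactElement c}) :
    IsCompactElement (principalOpen c ⊓ principalOpen d) := by
  by_cases h : ∃ v, c.1 ≤ v ∧ d.1 ≤ v
  · obtain ⟨v, hcv, hdv⟩ := h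
    obtain ⟨e, he⟩ := hD.bounded_complete {c.1, d.1} ⟨v, by
      rintro _ (rfl | rfl)
      exacts [hcv, hdv]⟩
    have hce : c.1 ≤ e := he.1 (Or.inl rfl)
    have hde : d.1 ≤ e := he.1 (Or.inr rfl)
    have hle {y : D} (h1 : c.1 ≤ y) (h2 : d.1 ≤ y) : e ≤ y := he.2 (by
      rintro _ (rfl | rfl)
      exacts [h1, h2])
    have hec : IsCompactElement e := by
      intro s u hs hdir hu heu
      obtain ⟨x, hx, hcx⟩ := c.2 s u hs hdir hu (hce.trans heu)
      obtain ⟨y, hy, hdy⟩ := d.2 s u hs hdir hu (hde.trans heu)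
      obtain ⟨z, hz, hxz, hyz⟩ := hdir x hx y hy
      exact ⟨z, hz, hle (hcx.trans hxz) (hdy.trans hyz)⟩
    have : principalOpen c ⊓ principalOpen d = principalOpen ⟨e, hec⟩ :=
      le_antisymm (fun x hx => hle hx.1 hx.2)
        (le_inf (principalOpen_le_iff.2 hce) (principalOpen_le_iff.2 hde))
    rw [this]
    exact isCompactElement_principalOpen _
  · have : principalOpen c ⊓ principalOpen d = ⊥ :=
      le_bot_iff.1 fun x hx => (h ⟨_, hx.1, hx.2⟩).elim
    rw [this]
    exact isCompactElement_bot

theorem IsScottDomain.exists_finset_principalOpen {U : ScottLocale D} (hU : IsCompactElement U) :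
    ∃ F : Finset {c : D // IsCompactElement c}, U = F.sup principalOpen := by
  classical
  obtain ⟨F, hF⟩ := CompleteLattice.IsCompactElement.exists_finset_of_le_iSup _ hU
    (fun c : {c : {c : D // IsCompactElement c} // WithScott.toScott c.1 ∈ U} =>
      principalOpen c.1) (hD.eq_iSup_principalOpen U).le
  refine ⟨F.image Subtype.val, le_antisymm ?_ ?_⟩
  · rw [Finset.sup_image, Finset.sup_eq_iSup]
    exact hF
  · refine Finset.sup_le fun c hc => ?_
    obtain ⟨c, -, rfl⟩ := Finset.mem_image.1 hc
    exact principalOpen_le_iff.2 c.2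

theorem IsScottDomain.isSpectralLocale : IsSpectralLocale (ScottLocale D) := by
  refine isSpectralLocale_iff.2 ⟨hD.isCompactlyGenerated, ?_, fun U V hU hV => ?_⟩
  · obtain ⟨c, hc⟩ := hD.exists_principalOpen_eq_top
    exact hc ▸ isCompactElement_principalOpen c
  · obtain ⟨F, rfl⟩ := hD.exists_finset_principalOpen hU
    obtain ⟨G, rfl⟩ := hD.exists_finset_principalOpen hV
    rw [Finset.sup_inf_sup]
    exact CompleteLattice.isCompactElement_finsetSup _ fun p _ =>
      hD.isCompactElement_principalOpen_inf p.1 p.2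

omit hD in
/-- The point `U ↦ (x ∈ U)` of the Scott locale. -/
def pointOf (x : D) : Pt (ScottLocale D) where
  toFun U := WithScott.toScott x ∈ U
  map_inf' _ _ := rfl
  map_top' := eq_true trivial
  map_sSup' S := by
    refine propext ⟨fun h => ?_, fun h => ?_⟩
    · obtain ⟨U, hU, h⟩ := TopologicalSpace.Opens.mem_sSup.1 h
      exact ⟨_, ⟨U, hU, rfl⟩, h⟩
    · obtain ⟨_, ⟨U, hU, rfl⟩, h⟩ := h
      exact TopologicalSpace.Opens.mem_sSup.2 ⟨U, hU, h⟩

theorem IsScottDomain.pointOf_injective : Function.Injective (pointOf : D → Pt (ScottLocale D)) := by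
  have key (x y : D) (h : pointOf x = pointOf y) : x ≤ y := by
    refine (hD.isLUB_below x).2 fun c hc => ?_
    have := DFunLike.congr_fun h (principalOpen ⟨c, hc.1⟩)
    exact this.mp hc.2
  exact fun x y h => le_antisymm (key x y h) (key y x h.symm)

omit hD in
theorem pt_mono (p : Pt (ScottLocale D)) {U V : ScottLocale D} (h : U ≤ V) (hU : p U) : p V :=
  OrderHomClass.mono p h hU

/-- Points preserve joins, so their values on principal opens determine them. -/
theorem IsScottDomain.pt_iff (p : Pt (ScottLocale D)) (U : ScottLocale D) :
    p U ↔ ∃ c, WithScott.toScott c.1 ∈ U ∧ p (principalOpen c) := by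
  constructor
  · intro h
    rw [hD.eq_iSup_principalOpen U, map_iSup] at h
    obtain ⟨c, hc⟩ := iSup_Prop_eq.mp h
    exact ⟨c.1, c.2, hc⟩
  · rintro ⟨c, hc, h⟩
    exact pt_mono p (principalOpen_le_iff.2 hc) h

/-- The element is the join of the finite `c` whose principal open satisfies `p`. These form a
directed set because `p` preserves binary meets and, by `pt_iff`, a meet satisfying `p` contains a
further such element. -/
theorem IsScottDomain.pointOf_surjective :
    Function.Surjective (pointOf : D → Pt (ScottLocale D)) := by
  intro p
  let s : Set D := {c | ∃ hc : IsCompactElement c, p (principalOpen ⟨c, hc⟩)}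
  have hs : s.Nonempty := by
    obtain ⟨c, hc⟩ := hD.exists_principalOpen_eq_top
    exact ⟨c.1, c.2, by rw [hc, map_top]; trivial⟩
  have hdir : DirectedOn (· ≤ ·) s := by
    rintro c ⟨hc, hpc⟩ d ⟨hd, hpd⟩
    have h : p (principalOpen ⟨c, hc⟩ ⊓ principalOpen ⟨d, hd⟩) := by
      rw [map_inf]
      exact ⟨hpc, hpd⟩
    obtain ⟨e, he, hpe⟩ := (hD.pt_iff p _).1 h
    exact ⟨e.1, ⟨e.2, hpe⟩, he.1, he.2⟩
  obtain ⟨x, hx⟩ := hD.exists_isLUB s hs hdir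
  refine ⟨x, DFunLike.ext _ _ fun U => propext ?_⟩
  rw [hD.pt_iff p U]
  constructor
  · intro hU
    obtain ⟨c, ⟨hc, hpc⟩, hcU⟩ := scottLocale_exists_mem U hs hdir hx hU
    exact ⟨⟨c, hc⟩, hcU, hpc⟩
  · rintro ⟨c, hcU, hpc⟩
    exact scottLocale_mem_of_le U (hx.1 ⟨c.2, hpc⟩) hcU

/-- The sharp elements of a Scott domain are the spectral points of its Scott locale. -/
theorem IsScottDomain.exists_sharp_equiv :
    ∃ e₁ : Sharp D ≃ SpecPt (ScottLocale D), ∀ (x : Sharp D) (U : ScottLocale D),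
      (e₁ x).1 U ↔ WithScott.toScott x.1 ∈ U := by
  refine ⟨.ofBijective (fun x => ⟨pointOf x.1, isSpectralHom_point _⟩) ⟨fun x y h => ?_,
    fun p => ?_⟩, fun _ _ => Iff.rfl⟩
  · exact Subtype.ext (hD.pointOf_injective (congrArg Subtype.val h))
  · obtain ⟨x, hx⟩ := hD.pointOf_surjective p.1
    -- Excluded middle supplies sharpness.
    exact ⟨⟨x, fun _ _ => em _⟩, Subtype.ext hx⟩

end ScottDomain

end PointFree

theorem mainTheorem10 :
    (∀ (D : Type u) [PartialOrder D], IsScottDomain D →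
      IsSpectralLocale (ScottLocale D) ∧
      ∃ (e₁ : Sharp D ≃ SpecPt (ScottLocale D))
        (e₂ : SpecPt (ScottLocale D) ≃ SpecPt (Patch (ScottLocale D)))
        (e₃ : SpecPt (Patch (ScottLocale D)) ≃ Pt (Patch (ScottLocale D))),
        (∀ (x : Sharp D) (U : ScottLocale D),
          (e₁ x).1 U ↔ Topology.WithScott.toScott x.1 ∈ U) ∧
        (∀ p, (e₂ p).1.comp (patchCounit (ScottLocale D)) = p.1) ∧
        (∀ p, e₃ p = p.1)) ∧
    (∀ (X : Type u) [Order.Frame X], IsSpectralLocale X →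
      IsPatchOf (patchCounit X) ∧
      ∃ (e₂ : SpecPt X ≃ SpecPt (Patch X)) (e₃ : SpecPt (Patch X) ≃ Pt (Patch X)),
        (∀ p, (e₂ p).1.comp (patchCounit X) = p.1) ∧
        (∀ p, e₃ p = p.1)) := by
  refine ⟨fun D _ hD => ⟨hD.isSpectralLocale, ?_⟩,
    fun X _ hX => ⟨isPatchOf_patchCounit hX, exists_specPt_equiv hX⟩⟩
  obtain ⟨e₁, h₁⟩ := hD.exists_sharp_equiv
  obtain ⟨e₂, e₃, h₂, h₃⟩ := exists_specPt_equiv hD.isSpectralLocale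
  exact ⟨e₁, e₂, e₃, h₁, h₂, h₃⟩
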